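/- Let $X$ be a nonempty Tychonoff space with $iw(X)=\aleph_0$; here $iw(X)$ is the smallest infinite cardinal $\tau$ such that $X$ admits a one-to-one continuous map onto a Tychonoff space having a base of cardinality at most $\tau$ (so the hypothesis says that $X$ has a coarser second-countable Tychonoff topology). Let $C_p(X)$ be the space of continuous real-valued functions on $X$ with the topology of pointwise convergence, and let $\mathbf 0\in C_p(X)$ be the constant function $0$. Let $\Omega$ be the family of all open $\omega$-covers of $X$, that is, of all families $\mathcal U$ of open subsets of $X$ with $\bigcup\mathcal U=X$ and $X\notin\mathcal U$ such that every finite subset of $X$ is contained in a member of $\mathcal U$. Let $\mathcal D$ be the family of all dense subsets of $C_p(X)$, and let $\Omega_{\mathbf 0}=\{A\subseteq C_p(X):\mathbf 0\in\overline{A}\setminus A\}$. For families of sets $\mathcal A,\mathcal B$, in round $n\in\omega$ of the game $G_{fin}(\mathcal A,\mathcal B)$ player ONE chooses $A_n\in\mathcal A$ and TWO answers with a finite set $B_n\subseteq A_n$; TWO wins if $\bigcup_{n\in\omega}B_n\in\mathcal B$. In $G_1(\mathcal A,\mathcal B)$, TWO answers with a point $b_n\in A_n$ and wins if $\{b_n:n\in\omega\}\in\mathcal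 B$. A strategy for TWO assigns to every finite sequence $\langle A_0,\dots,A_n\rangle$ of moves of ONE a legal answer to $A_n$; a Markov strategy for TWO assigns a legal answer to $A_n$ depending only on $A_n$ and $n$. Such a strategy is winning if TWO, following it, wins against every sequence $(A_n)_{n\in\omega}$ of elements of $\mathcal A$. Let $*\in\{1,fin\}$. Then the following are equivalent: 1. TWO has a winning strategy in $G_*(\Omega,\Omega)$ on $X$; 2. TWO has a winning strategy in $G_*(\Omega_{\mathbf 0},\Omega_{\mathbf 0})$ on $C_p(X)$; 3. TWO has a winning strategy in $G_*(\mathcal D,\Omega_{\mathbf 0})$ on $C_p(X)$; 4. TWO has a winning strategy in $G_*(\mathcal D,\mathcal D)$ on $C_p(X)$. Moreover, the four statements obtained from 1-4 by replacing "winning strategy" by "winning Markov strategy" are equivalent to each other. -/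

import Mathlib

open Set

open scoped Cardinal

universe u

namespace SelGame

/-- The two kinds of selection games `G_1` and `G_fin`. -/
inductive Kind where
  | one
  | fin

/-- `IsReply k A B`: the set `B` is a legal reply of TWO to the move `A` of ONE. In `G_fin` this is
a finite subset of `A`; in `G_1` it is a point of `A`, recorded as a singleton, so that in
both games the outcome of a play is the union of the replies. -/
def IsReply {α : Type u} (k : Kind) (A B : Set α) : Prop :=
  match k with
  | .one => ∃ b ∈ A, B = {b}
  | .fin => B.Finite ∧ B ⊆ A

/-- TWO has a winning (perfect information) strategy in `G_k(𝒜, ℬ)`: the reply in round `n` depends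
on the moves `A₀, …, Aₙ` of ONE. -/
def TwoWins {α : Type u} (k : Kind) (𝒜 ℬ : Set (Set α)) : Prop :=
  ∃ σ : (n : ℕ) → (Fin (n + 1) → 𝒜) → Set α,
    (∀ n (a : Fin (n + 1) → 𝒜), IsReply k (a (Fin.last n) : Set α) (σ n a)) ∧
    ∀ A : ℕ → 𝒜, (⋃ n, σ n (fun i => A i)) ∈ ℬ

/-- TWO has a winning Markov strategy in `G_k(𝒜, ℬ)`: the reply in round `n` depends only on
the last move `Aₙ` of ONE and on `n`. -/
def TwoWinsMarkov {α : Type u} (k : Kind) (𝒜 ℬ : Set (Set α)) : Prop :=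
  ∃ σ : 𝒜 → ℕ → Set α,
    (∀ (A : 𝒜) (n : ℕ), IsReply k (A : Set α) (σ A n)) ∧
    ∀ A : ℕ → 𝒜, (⋃ n, σ (A n) n) ∈ ℬ

/-- `Ω`: the (nontrivial) open `ω`-covers of `X`. -/
def omegaCovers (X : Type u) [TopologicalSpace X] : Set (Set (Set X)) :=
  {𝒰 | (∀ U ∈ 𝒰, IsOpen U) ∧ ⋃₀ 𝒰 = univ ∧ univ ∉ 𝒰 ∧
    ∀ F : Set X, F.Finite → ∃ U ∈ 𝒰, F ⊆ U}

/-- `Ω_x`: the sets that do not contain `x` but have `x` in their closure. -/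
def clusterSets {Y : Type u} [TopologicalSpace Y] (x : Y) : Set (Set Y) :=
  {A | x ∈ closure A \ A}

/-- `𝒟`: the dense subsets of `Y`. -/
def denseSets (Y : Type u) [TopologicalSpace Y] : Set (Set Y) :=
  {D | Dense D}

/-- `C_p(X)`: the continuous real-valued functions on `X` with the topology of pointwise
convergence, that is, with the subspace topology of the product topology on `X → ℝ`. -/
abbrev Cp (X : Type u) [TopologicalSpace X] : Type u :=
  {f : X → ℝ // Continuous f}

/-- The constant function `0` in `C_p(X)`. -/
def Cp.zero (X : Type u) [TopologicalSpace X] : Cp X :=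
  ⟨fun _ => 0, continuous_const⟩

/-- The weight of a space: the smallest cardinality of a base. -/
noncomputable def weight (Y : Type u) [TopologicalSpace Y] : Cardinal.{u} :=
  sInf {c | ∃ B : Set (Set Y), TopologicalSpace.IsTopologicalBasis B ∧ #B = c}

/-- The `i`-weight of a space: the smallest infinite cardinal `τ` such that `X` has a one-to-one
continuous map onto a Tychonoff space of weight at most `τ`. -/
noncomputable def iw (X : Type u) [TopologicalSpace X] : Cardinal.{u} :=
  sInf {τ | ℵ₀ ≤ τ ∧ ∃ (Y : Type u) (_ : TopologicalSpace Y) (f : X → Y),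
    T35Space Y ∧ Continuous f ∧ Function.Bijective f ∧ weight Y ≤ τ}

end SelGame

/-!
The equivalences all come from moving strategies for TWO between games. If every move of ONE in a
game `G'` is turned, round by round, into a move of a game `G`, and replies in `G` are turned back
into replies in `G'`, then a strategy for `G` becomes one for `G'`, and a Markov strategy becomes a
Markov strategy (`transfer`).

* From `(Ω, Ω)` to `(Ω₀, Ω₀)`: in round `n` the set `A` becomes the family of all preimages
  `{x | |f x| < 1 / (n + 1)}`, `f ∈ A`. It is an `ω`-cover unless some `f ∈ A` is uniformly smaller
  than `1 / (n + 1)`, and then TWO just plays this `f` (`transfer_omegaCovers_clusterSets`). The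
  outcome clusters at `0` because a nontrivial `ω`-cover stays one when finitely many members are
  removed (`exists_mem_diff_of_mem_omegaCovers`), so that early rounds can be ignored.
* From `(Ω₀, Ω₀)` to `(𝒟, Ω₀)`, and from `(𝒟, 𝒟)` to `(𝒟, Ω₀)`: a dense `D` becomes `D \ {0}`,
  which is dense as `C_p(X)` has no isolated points.
* From `(𝒟, Ω₀)` to `(Ω, Ω)`: a cover `𝒰` becomes the set of all `f` that are `1` outside some
  member of `𝒰`, which is dense by complete regularity; if such an `f` is smaller than `1` on `F`,
  then `F` lies in that member (`transfer_denseSets_omegaCovers`).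
* From `(𝒟, Ω₀)` to `(𝒟, 𝒟)`: by translation TWO can make the outcome cluster at any given point.
  The hypothesis on `iw X` makes `C_p(X)` separable (`separableSpace_Cp`): `X` maps injectively
  into a compact metrizable space `K`, and `C(K, ℝ)` is separable. The rounds are split into
  infinitely many infinite threads, and TWO makes the outcome of each thread cluster at one point
  of a countable dense set (`twoWins_threads`, `twoWinsMarkov_threads`).
-/

open Topology

namespace SelGame

/-! ### Moving strategies between games -/

section Games

variable {α β : Type u} {k : Kind}

theorem IsReply.subset {A B : Set α} (h : IsReply k A B) : B ⊆ A := by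
  cases k with
  | one => obtain ⟨b, hb, rfl⟩ := h; simpa using hb
  | fin => exact h.2

theorem IsReply.finite {A B : Set α} (h : IsReply k A B) : B.Finite := by
  cases k with
  | one => obtain ⟨b, hb, rfl⟩ := h; exact finite_singleton b
  | fin => exact h.1

theorem isReply_singleton {A : Set α} {b : α} (hb : b ∈ A) : IsReply k A {b} := by
  cases k with
  | one => exact ⟨b, hb, rfl⟩
  | fin => exact ⟨finite_singleton b, by simpa using hb⟩

theorem IsReply.image {A B : Set α} {A' : Set β} {f : α → β} (h : IsReply k A B)
    (hf : MapsTo f A A') : IsReply k A' (f '' B) := by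
  cases k with
  | one => obtain ⟨b, hb, rfl⟩ := h; exact ⟨f b, hf hb, image_singleton⟩
  | fin => exact ⟨h.1.image f, (image_mono h.2).trans hf.image_subset⟩

theorem IsReply.mono {A A' B : Set α} (h : IsReply k A B) (hA : A ⊆ A') : IsReply k A' B := by
  simpa using h.image (f := id) hA

theorem TwoWinsMarkov.twoWins {𝒜 ℬ : Set (Set α)} (h : TwoWinsMarkov k 𝒜 ℬ) :
    TwoWins k 𝒜 ℬ := by
  obtain ⟨σ, hσ, hw⟩ := h
  exact ⟨fun n a => σ (a (Fin.last n)) n, fun n a => hσ _ _, fun A => by simpa using hw A⟩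

/-- Strategies for TWO pass from `G_k(𝒜, ℬ)` to `G_k(𝒜', ℬ')` along a translation `φ` of the moves
of ONE and a translation `ψ` back of the replies of TWO. Both may depend on the round and on the
current move, but not on earlier ones, so that Markov strategies pass to Markov strategies. -/
theorem transfer {𝒜 ℬ : Set (Set α)} {𝒜' ℬ' : Set (Set β)}
    (φ : ℕ → 𝒜' → 𝒜) (ψ : ℕ → 𝒜' → Set α → Set β)
    (hψ : ∀ n A B, IsReply k (φ n A : Set α) B → IsReply k (A : Set β) (ψ n A B))
    (hout : ∀ (A : ℕ → 𝒜') (B : ℕ → Set α), (∀ n, IsReply k (φ n (A n) : Set α) (B n)) →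
      (⋃ n, B n) ∈ ℬ → (⋃ n, ψ n (A n) (B n)) ∈ ℬ') :
    (TwoWins k 𝒜 ℬ → TwoWins k 𝒜' ℬ') ∧ (TwoWinsMarkov k 𝒜 ℬ → TwoWinsMarkov k 𝒜' ℬ') := by
  constructor
  · rintro ⟨σ, hσ, hw⟩
    refine ⟨fun n a => ψ n (a (Fin.last n)) (σ n fun i => φ i (a i)), fun n a => ?_, fun A => ?_⟩
    · exact hψ _ _ _ (by simpa using hσ n fun i => φ i (a i))
    · have := hout A (fun n => σ n fun i => φ i (A i))
        (fun n => by simpa using hσ n fun i => φ i (A i)) (hw fun n => φ n (A n))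
      simpa using this
  · rintro ⟨σ, hσ, hw⟩
    exact ⟨fun A n => ψ n A (σ (φ n A) n), fun A n => hψ _ _ _ (hσ _ _),
      fun A => hout A _ (fun n => hσ _ _) (hw fun n => φ n (A n))⟩

/-- If TWO can win for each of countably many families `ℬ i`, then TWO can make a single outcome
contain a member of every `ℬ i`: the `i`-th strategy is followed in the rounds `Nat.pair i j`,
`j ∈ ℕ`. -/
theorem twoWins_threads {𝒜 : Set (Set α)} {ℬ : ℕ → Set (Set α)} (h : ∀ i, TwoWins k 𝒜 (ℬ i)) :
    TwoWins k 𝒜 {C | ∀ i, ∃ B ∈ ℬ i, B ⊆ C} := by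
  choose σ hσ hw using h
  have hle : ∀ n (m : Fin (n.unpair.2 + 1)), Nat.pair n.unpair.1 m < n + 1 := fun n m => by
    have h1 : Nat.pair n.unpair.1 m ≤ Nat.pair n.unpair.1 n.unpair.2 := by
      rcases (Nat.lt_succ_iff.1 m.2).lt_or_eq with h | h
      · exact (Nat.pair_lt_pair_right _ h).le
      · exact (congrArg _ h).le
    rw [Nat.pair_unpair] at h1
    exact Nat.lt_succ_of_le h1
  refine ⟨fun n a => σ n.unpair.1 n.unpair.2 fun m => a ⟨Nat.pair n.unpair.1 m, hle n m⟩,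
    fun n a => ?_, fun A i => ⟨_, hw i fun j => A (Nat.pair i j), ?_⟩⟩
  · have := hσ n.unpair.1 n.unpair.2 fun m => a ⟨Nat.pair n.unpair.1 m, hle n m⟩
    have e : (⟨Nat.pair n.unpair.1 (Fin.last n.unpair.2), hle n (Fin.last _)⟩ : Fin (n + 1))
        = Fin.last n := Fin.ext (by simp)
    rwa [e] at this
  · refine iUnion_subset fun j => ?_
    refine Subset.trans ?_ (subset_iUnion _ (Nat.pair i j))
    have key : ∀ p : ℕ × ℕ, p = (i, j) → σ i j (fun m => A (Nat.pair i m)) ⊆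
        σ p.1 p.2 fun m => A (Nat.pair p.1 m) := by
      rintro _ rfl
      exact Subset.rfl
    exact key _ (Nat.unpair_pair i j)

theorem twoWinsMarkov_threads {𝒜 : Set (Set α)} {ℬ : ℕ → Set (Set α)}
    (h : ∀ i, TwoWinsMarkov k 𝒜 (ℬ i)) : TwoWinsMarkov k 𝒜 {C | ∀ i, ∃ B ∈ ℬ i, B ⊆ C} := by
  choose σ hσ hw using h
  refine ⟨fun A n => σ n.unpair.1 A n.unpair.2, fun A n => hσ _ _ _,
    fun A i => ⟨_, hw i fun j => A (Nat.pair i j), iUnion_subset fun j => ?_⟩⟩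
  refine Subset.trans ?_ (subset_iUnion _ (Nat.pair i j))
  simp

end Games

/-! ### Pointwise convergence and interpolation -/

section FunctionSpace

variable {X : Type u} [TopologicalSpace X]

theorem mem_closure_Cp {A : Set (Cp X)} {f : Cp X} :
    f ∈ closure A ↔ ∀ F : Set X, F.Finite → ∀ ε > 0, ∃ a ∈ A, ∀ x ∈ F, |a.1 x - f.1 x| < ε := by
  rw [mem_closure_iff_nhds]
  constructor
  · intro h F hF ε hε
    have hmem : {a : Cp X | ∀ x ∈ F, |a.1 x - f.1 x| < ε} ∈ 𝓝 f := by
      refine (hF.eventually_all (l := 𝓝 f) (p := fun x a => |a.1 x - f.1 x| < ε)).2 fun x _ => ?_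
      have hc : Continuous fun a : Cp X => |a.1 x - f.1 x| :=
        (((continuous_apply x).comp continuous_subtype_val).sub continuous_const).abs
      exact hc.continuousAt.eventually_lt continuousAt_const (by simpa using hε)
    obtain ⟨a, ha, haA⟩ := h _ hmem
    exact ⟨a, haA, ha⟩
  · intro h t ht
    obtain ⟨s, hs, hst⟩ := (mem_nhds_induced Subtype.val f t).1 ht
    rw [nhds_pi, Filter.mem_pi] at hs
    obtain ⟨I, hI, v, hv, hvs⟩ := hs
    have : ∀ x, ∃ ε > 0, Metric.ball (f.1 x) ε ⊆ v x := fun x => Metric.mem_nhds_iff.1 (hv x)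
    choose δ hδ hδv using this
    obtain ⟨ε, hε, hεδ⟩ : ∃ ε > 0, ∀ x ∈ I, ε ≤ δ x := by
      rcases I.eq_empty_or_nonempty with rfl | hne
      · exact ⟨1, one_pos, by simp⟩
      · obtain ⟨x, hx, hmin⟩ := exists_min_image I δ hI hne
        exact ⟨δ x, hδ x, hmin⟩
    obtain ⟨a, haA, ha⟩ := h I hI ε hε
    refine ⟨a, hst (hvs fun x hx => hδv x ?_), haA⟩
    rw [Metric.mem_ball, Real.dist_eq]
    exact (ha x hx).trans_le (hεδ x hx)

/-- In a Tychonoff space, values on a finite set can be prescribed together with the value `1` on a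
disjoint closed set. -/
theorem exists_continuous_eqOn_finite [T35Space X] {F U : Set X} (hF : F.Finite) (hU : IsOpen U)
    (hFU : F ⊆ U) (v : X → ℝ) :
    ∃ h : X → ℝ, Continuous h ∧ (∀ x ∈ F, h x = v x) ∧ ∀ x ∉ U, h x = 1 := by
  classical
  have hex : ∀ x ∈ F, ∃ φ : X → ℝ, Continuous φ ∧ φ x = 0 ∧ ∀ y ∈ F \ {x} ∪ Uᶜ, φ y = 1 := by
    intro x hx
    have hcl : IsClosed (F \ {x} ∪ Uᶜ) := hF.sdiff.isClosed.union hU.isClosed_compl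
    obtain ⟨φ, hφ, h0, h1⟩ := CompletelyRegularSpace.completely_regular x _ hcl
      (by simp [hFU hx])
    exact ⟨fun y => φ y, continuous_subtype_val.comp hφ, by simp [h0], fun y hy => by simp [h1 hy]⟩
  choose! φ hφ h0 h1 using hex
  refine ⟨fun y => 1 + ∑ x ∈ hF.toFinset, (v x - 1) * (1 - φ x y), ?_, fun y hy => ?_,
    fun y hy => ?_⟩
  · refine continuous_const.add (continuous_finsetSum _ fun x hx => ?_)
    exact continuous_const.mul (continuous_const.sub (hφ x (by simpa using hx)))
  · have : ∑ x ∈ hF.toFinset, (v x - 1) * (1 - φ x y) = (v y - 1) * (1 - φ y y) := by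
      refine Finset.sum_eq_single_of_mem y (by simpa using hy) fun x hx hxy => ?_
      rw [h1 x (by simpa using hx) y (Or.inl ⟨hy, Ne.symm hxy⟩)]
      ring
    simp only [this, h0 y hy]
    ring
  · have : ∑ x ∈ hF.toFinset, (v x - 1) * (1 - φ x y) = 0 := by
      refine Finset.sum_eq_zero fun x hx => ?_
      rw [h1 x (by simpa using hx) y (Or.inr hy)]
      ring
    simp only [this, add_zero]

/-- `C_p(X)` has no isolated points, so removing `0` keeps a set dense. -/
theorem dense_diff_zero [Nonempty X] {D : Set (Cp X)} (hD : Dense D) :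
    Dense (D \ {Cp.zero X}) := by
  have : Filter.NeBot (𝓝[≠] Cp.zero X) := by
    rw [← mem_closure_iff_nhdsWithin_neBot, mem_closure_Cp]
    intro F _ ε hε
    refine ⟨⟨fun _ => ε / 2, continuous_const⟩, fun h => ?_, fun x _ => ?_⟩
    · obtain ⟨x⟩ := ‹Nonempty X›
      have := congrFun (congrArg Subtype.val h) x
      simp only [Cp.zero] at this
      linarith
    · simp only [Cp.zero, sub_zero, abs_of_pos (half_pos hε)]
      linarith
  exact hD.sdiff_singleton _

end FunctionSpace

/-! ### Separability of the function space -/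

section Separable

variable {X : Type u} [TopologicalSpace X]

theorem exists_continuous_injective_of_iw (hX : iw X = ℵ₀) :
    ∃ e : X → ℕ → unitInterval, Continuous e ∧ Function.Injective e := by
  -- `sInf ∅ = 0` for cardinals, so `iw X = ℵ₀` forces the infimum to be attained.
  have hmem := csInf_mem (s := {τ : Cardinal.{u} | ℵ₀ ≤ τ ∧ ∃ (Y : Type u)
      (_ : TopologicalSpace Y) (f : X → Y),
      T35Space Y ∧ Continuous f ∧ Function.Bijective f ∧ weight Y ≤ τ}) (by
    by_contra hne
    rw [not_nonempty_iff_eq_empty] at hne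
    rw [iw, hne, Cardinal.sInf_empty] at hX
    exact Cardinal.aleph0_ne_zero hX.symm)
  change iw X ∈ _ at hmem
  rw [hX] at hmem
  obtain ⟨-, Y, _, f, _, hf, hbij, hw⟩ := hmem
  have hB := csInf_mem (s := {c : Cardinal.{u} | ∃ B : Set (Set Y),
    TopologicalSpace.IsTopologicalBasis B ∧ #B = c})
    ⟨_, _, TopologicalSpace.isTopologicalBasis_opens, rfl⟩
  obtain ⟨B, hB, hcard⟩ := hB
  have : SecondCountableTopology Y :=
    hB.secondCountableTopology (Cardinal.le_aleph0_iff_set_countable.1 (hcard.trans_le hw))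
  obtain ⟨j, hj⟩ := TopologicalSpace.exists_embedding_l_infty Y
  refine ⟨fun x n => unitInterval.sigmoid (j (f x) n), continuous_pi fun n => ?_, fun x y hxy => ?_⟩
  · exact unitInterval.continuous_sigmoid.comp
      ((continuous_eval_const n).comp (hj.continuous.comp hf))
  · refine hbij.1 (hj.injective (DFunLike.ext _ _ fun n => ?_))
    exact unitInterval.sigmoid_injective (congrFun hxy n)

theorem separableSpace_Cp (hX : iw X = ℵ₀) : TopologicalSpace.SeparableSpace (Cp X) := by
  obtain ⟨e, he, hinj⟩ := exists_continuous_injective_of_iw hX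
  let r : C(ℕ → unitInterval, ℝ) → Cp X := fun g => ⟨g ∘ e, g.continuous.comp he⟩
  have hr : Continuous r :=
    Continuous.subtype_mk (continuous_pi fun x => continuous_eval_const (e x)) _
  have hd : DenseRange r := fun f => by
    rw [mem_closure_Cp]
    intro F hF ε hε
    obtain ⟨h, hh, hF', -⟩ := exists_continuous_eqOn_finite (hF.image e) isOpen_univ
      (subset_univ _) (Function.extend e f.1 0)
    refine ⟨_, ⟨⟨h, hh⟩, rfl⟩, fun x hx => ?_⟩
    have : h (e x) = f.1 x := by
      rw [hF' _ (mem_image_of_mem e hx), hinj.extend_apply]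
    simpa [r, this] using hε
  exact hd.separableSpace hr

end Separable

/-! ### Translating moves between the space and its function space -/

section Transfers

variable {X : Type u} [TopologicalSpace X] {k : Kind}

theorem exists_mem_diff_of_mem_omegaCovers {𝒰 S : Set (Set X)} (h𝒰 : 𝒰 ∈ omegaCovers X)
    (hS : S.Finite) {F : Set X} (hF : F.Finite) : ∃ U ∈ 𝒰 \ S, F ⊆ U := by
  obtain ⟨-, -, huniv, hω⟩ := h𝒰
  have hex : ∀ U ∈ S ∩ 𝒰, ∃ x, x ∉ U := fun U hU => by
    by_contra! h
    exact huniv (eq_univ_of_forall h ▸ hU.2)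
  have : Nonempty X := by
    obtain ⟨U, hU, -⟩ := hω ∅ finite_empty
    by_contra h
    rw [not_nonempty_iff] at h
    exact huniv (eq_univ_of_forall (fun x => (h.false x).elim) ▸ hU)
  choose! p hp using hex
  -- A member containing the points `p U ∉ U` differs from each of the removed `U`.
  obtain ⟨U, hU, hFU⟩ := hω (F ∪ p '' (S ∩ 𝒰)) (hF.union ((hS.inter_of_left 𝒰).image p))
  refine ⟨U, ⟨hU, fun hUS => ?_⟩, subset_union_left.trans hFU⟩
  exact hp U ⟨hUS, hU⟩ (hFU (Or.inr (mem_image_of_mem p ⟨hUS, hU⟩)))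

/-- The set where `f` is smaller than `1 / (n + 1)` in absolute value. -/
def smallSet (n : ℕ) (f : Cp X) : Set X :=
  {x | |f.1 x| < 1 / ((n : ℝ) + 1)}

theorem image_smallSet_mem_omegaCovers {A : Set (Cp X)} (hA : A ∈ clusterSets (Cp.zero X)) (n : ℕ)
    (h : univ ∉ smallSet n '' A) : smallSet n '' A ∈ omegaCovers X := by
  have hω : ∀ F : Set X, F.Finite → ∃ U ∈ smallSet n '' A, F ⊆ U := fun F hF => by
    obtain ⟨a, ha, haF⟩ := mem_closure_Cp.1 hA.1 F hF (1 / ((n : ℝ) + 1)) (by positivity)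
    exact ⟨_, mem_image_of_mem _ ha, fun x hx => by simpa [smallSet, Cp.zero] using haF x hx⟩
  refine ⟨?_, eq_univ_of_forall fun x => ?_, h, hω⟩
  · rintro _ ⟨f, -, rfl⟩
    exact isOpen_lt f.2.abs continuous_const
  · obtain ⟨U, hU, hx⟩ := hω {x} (finite_singleton x)
    exact ⟨U, hU, hx rfl⟩

/-- A union of replies to sets in `Ω₀` is in `Ω₀` as soon as it clusters at `0`. -/
theorem iUnion_mem_clusterSets {A B : ℕ → Set (Cp X)} (hA : ∀ n, Cp.zero X ∉ A n)
    (hB : ∀ n, B n ⊆ A n)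
    (h : ∀ F : Set X, F.Finite → ∀ ε > 0, ∃ n, ∃ f ∈ B n, ∀ x ∈ F, |f.1 x| < ε) :
    (⋃ n, B n) ∈ clusterSets (Cp.zero X) := by
  refine ⟨mem_closure_Cp.2 fun F hF ε hε => ?_, fun h0 => ?_⟩
  · obtain ⟨n, f, hf, hfF⟩ := h F hF ε hε
    exact ⟨f, mem_iUnion_of_mem n hf, by simpa [Cp.zero] using hfF⟩
  · obtain ⟨n, hn⟩ := mem_iUnion.1 h0
    exact hA n (hB n hn)

/-- If `X` has no nontrivial `ω`-covers (as when `X` is finite), every set in `Ω₀` has members that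
are uniformly as small as desired, and playing these is a winning Markov strategy. -/
theorem twoWinsMarkov_clusterSets_of_isEmpty (h : omegaCovers X = ∅) :
    TwoWinsMarkov k (clusterSets (Cp.zero X)) (clusterSets (Cp.zero X)) := by
  have hex : ∀ (A : clusterSets (Cp.zero X)) (n : ℕ), univ ∈ smallSet n '' (A : Set (Cp X)) :=
    fun A n => by
      by_contra hn
      have := image_smallSet_mem_omegaCovers A.2 n hn
      simp [h] at this
  choose f hfA hf using hex
  refine ⟨fun A n => {f A n}, fun A n => isReply_singleton (hfA A n), fun A => ?_⟩
  refine iUnion_mem_clusterSets (A := fun n => (A n : Set (Cp X))) (fun n => (A n).2.2)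
    (fun n => by simpa using hfA (A n) n) fun F _ ε hε => ?_
  obtain ⟨n, hn⟩ := exists_nat_one_div_lt hε
  refine ⟨n, _, rfl, fun x _ => lt_trans ?_ hn⟩
  have : x ∈ smallSet n (f (A n) n) := by rw [hf]; trivial
  exact this

theorem transfer_omegaCovers_clusterSets :
    (TwoWins k (omegaCovers X) (omegaCovers X) →
      TwoWins k (clusterSets (Cp.zero X)) (clusterSets (Cp.zero X))) ∧
    (TwoWinsMarkov k (omegaCovers X) (omegaCovers X) →
      TwoWinsMarkov k (clusterSets (Cp.zero X)) (clusterSets (Cp.zero X))) := by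
  classical
  rcases (omegaCovers X).eq_empty_or_nonempty with hemp | ⟨𝒲, h𝒲⟩
  · exact ⟨fun _ => (twoWinsMarkov_clusterSets_of_isEmpty hemp).twoWins,
      fun _ => twoWinsMarkov_clusterSets_of_isEmpty hemp⟩
  -- `g n A U` is an element of `A` whose `smallSet n` is `U`.
  have hex : ∀ (n : ℕ) (A : Set (Cp X)) (U : Set X), ∃ f, U ∈ smallSet n '' A →
      f ∈ A ∧ smallSet n f = U := fun n A U => by
    by_cases hU : U ∈ smallSet n '' A
    · obtain ⟨f, hf⟩ := hU
      exact ⟨f, fun _ => hf⟩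
    · exact ⟨Cp.zero X, fun h => absurd h hU⟩
  choose g hg using hex
  -- A round in which ONE offers a uniformly small function is played as a dummy round with `𝒲`.
  let φ : ℕ → clusterSets (Cp.zero X) → omegaCovers X := fun n A =>
    if h : univ ∈ smallSet n '' (A : Set (Cp X)) then ⟨𝒲, h𝒲⟩
    else ⟨_, image_smallSet_mem_omegaCovers A.2 n h⟩
  let ψ : ℕ → clusterSets (Cp.zero X) → Set (Set X) → Set (Cp X) := fun n A B =>
    if univ ∈ smallSet n '' (A : Set (Cp X)) then {g n A univ} else g n A '' B
  have hψ : ∀ n A B, IsReply k (φ n A : Set (Set X)) B → IsReply k (A : Set (Cp X)) (ψ n A B) := by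
    intro n A B hB
    by_cases h : univ ∈ smallSet n '' (A : Set (Cp X))
    · simp only [ψ, if_pos h]
      exact isReply_singleton (hg n A univ h).1
    · simp only [φ, dif_neg h] at hB
      simp only [ψ, if_neg h]
      exact hB.image fun U hU => (hg n A U hU).1
  refine transfer φ ψ hψ fun A B hB hout => ?_
  refine iUnion_mem_clusterSets (A := fun n => (A n : Set (Cp X))) (fun n => (A n).2.2)
    (fun n => (hψ n _ _ (hB n)).subset) fun F hF ε hε => ?_
  obtain ⟨N, hN⟩ := exists_nat_one_div_lt hε
  have hlt : ∀ n, N ≤ n → 1 / ((n : ℝ) + 1) < ε := fun n hn =>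
    (Nat.one_div_le_one_div hn).trans_lt hN
  by_cases hsmall : ∃ n, N ≤ n ∧ univ ∈ smallSet n '' (A n : Set (Cp X))
  · obtain ⟨n, hn, h⟩ := hsmall
    refine ⟨n, g n (A n) univ, by simp only [ψ, if_pos h]; rfl, fun x _ => ?_⟩
    have : x ∈ smallSet n (g n (A n) univ) := by rw [(hg n (A n) univ h).2]; trivial
    exact lt_trans this (hlt n hn)
  · push Not at hsmall
    obtain ⟨U, ⟨hU, hUS⟩, hFU⟩ := exists_mem_diff_of_mem_omegaCovers hout
      (S := ⋃ n ∈ Finset.range N, B n)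
      ((Finset.range N).finite_toSet.biUnion fun n _ => (hB n).finite) hF
    obtain ⟨n, hn⟩ := mem_iUnion.1 hU
    have hNn : N ≤ n := by
      by_contra hlt'
      exact hUS (mem_biUnion (by simpa using hlt') hn)
    have h := hsmall n hNn
    have hUn := (hB n).subset hn
    simp only [φ, dif_neg h] at hUn
    refine ⟨n, g n (A n) U, by simp only [ψ, if_neg h]; exact mem_image_of_mem _ hn, fun x hx => ?_⟩
    have : x ∈ smallSet n (g n (A n) U) := by rw [(hg n (A n) U hUn).2]; exact hFU hx
    exact lt_trans this (hlt n hNn)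

theorem transfer_clusterSets_denseSets [Nonempty X] :
    (TwoWins k (clusterSets (Cp.zero X)) (clusterSets (Cp.zero X)) →
      TwoWins k (denseSets (Cp X)) (clusterSets (Cp.zero X))) ∧
    (TwoWinsMarkov k (clusterSets (Cp.zero X)) (clusterSets (Cp.zero X)) →
      TwoWinsMarkov k (denseSets (Cp X)) (clusterSets (Cp.zero X))) :=
  transfer (fun _ D => ⟨(D : Set (Cp X)) \ {Cp.zero X}, dense_diff_zero D.2 _, fun h => h.2 rfl⟩)
    (fun _ _ B => B) (fun _ _ _ hB => hB.mono sdiff_subset) fun _ _ _ h => h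

theorem transfer_denseSets_clusterSets [Nonempty X] :
    (TwoWins k (denseSets (Cp X)) (denseSets (Cp X)) →
      TwoWins k (denseSets (Cp X)) (clusterSets (Cp.zero X))) ∧
    (TwoWinsMarkov k (denseSets (Cp X)) (denseSets (Cp X)) →
      TwoWinsMarkov k (denseSets (Cp X)) (clusterSets (Cp.zero X))) :=
  transfer (fun _ D => ⟨(D : Set (Cp X)) \ {Cp.zero X}, dense_diff_zero D.2⟩)
    (fun _ _ B => B) (fun _ _ _ hB => hB.mono sdiff_subset) fun _ B hB h => by
      refine ⟨h _, fun h0 => ?_⟩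
      obtain ⟨n, hn⟩ := mem_iUnion.1 h0
      exact ((hB n).subset hn).2 rfl

theorem transfer_denseSets_omegaCovers [T35Space X] :
    (TwoWins k (denseSets (Cp X)) (clusterSets (Cp.zero X)) →
      TwoWins k (omegaCovers X) (omegaCovers X)) ∧
    (TwoWinsMarkov k (denseSets (Cp X)) (clusterSets (Cp.zero X)) →
      TwoWinsMarkov k (omegaCovers X) (omegaCovers X)) := by
  let E : Set (Set X) → Set (Cp X) := fun 𝒰 => {f | ∃ U ∈ 𝒰, ∀ x ∉ U, f.1 x = 1}
  have hE : ∀ 𝒰 : omegaCovers X, E 𝒰 ∈ denseSets (Cp X) := fun 𝒰 f => by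
    rw [mem_closure_Cp]
    intro F hF ε hε
    obtain ⟨U, hU, hFU⟩ := 𝒰.2.2.2.2 F hF
    obtain ⟨h, hh, hhF, hhU⟩ := exists_continuous_eqOn_finite hF (𝒰.2.1 U hU) hFU f.1
    exact ⟨⟨h, hh⟩, ⟨U, hU, hhU⟩, fun x hx => by simpa [hhF x hx] using hε⟩
  have hex : ∀ (𝒰 : Set (Set X)) (f : Cp X), ∃ U, f ∈ E 𝒰 → U ∈ 𝒰 ∧ ∀ x ∉ U, f.1 x = 1 :=
    fun 𝒰 f => by
      by_cases hf : f ∈ E 𝒰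
      · obtain ⟨U, hU⟩ := hf
        exact ⟨U, fun _ => hU⟩
      · exact ⟨∅, fun h => absurd h hf⟩
  choose g hg using hex
  refine transfer (fun _ 𝒰 => ⟨E 𝒰, hE 𝒰⟩) (fun _ 𝒰 B => g 𝒰 '' B)
    (fun n 𝒰 B hB => hB.image fun f hf => (hg _ f hf).1) fun 𝒰 B hB hout => ?_
  have hsub : ∀ U ∈ ⋃ n, g (𝒰 n) '' B n, ∃ n, U ∈ (𝒰 n : Set (Set X)) := fun U hU => by
    obtain ⟨n, f, hf, rfl⟩ := mem_iUnion.1 hU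
    exact ⟨n, (hg _ f ((hB n).subset hf)).1⟩
  have hω : ∀ F : Set X, F.Finite → ∃ U ∈ ⋃ n, g (𝒰 n) '' B n, F ⊆ U := fun F hF => by
    obtain ⟨f, hf, hfF⟩ := mem_closure_Cp.1 hout.1 F hF 1 one_pos
    obtain ⟨n, hn⟩ := mem_iUnion.1 hf
    refine ⟨_, mem_iUnion_of_mem n (mem_image_of_mem _ hn), fun x hx => ?_⟩
    by_contra hxU
    have := hfF x hx
    simp [(hg _ f ((hB n).subset hn)).2 x hxU, Cp.zero] at this
  refine ⟨fun U hU => ?_, eq_univ_of_forall fun x => ?_, fun h => ?_, hω⟩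
  · obtain ⟨n, hn⟩ := hsub U hU
    exact (𝒰 n).2.1 U hn
  · obtain ⟨U, hU, hx⟩ := hω {x} (finite_singleton x)
    exact ⟨U, hU, hx rfl⟩
  · obtain ⟨n, hn⟩ := hsub _ h
    exact (𝒰 n).2.2.2.1 hn

/-- Translation by `d` turns strategies for clustering at `0` into strategies for clustering
at `d`. -/
theorem transfer_translate (d : Cp X) :
    (TwoWins k (denseSets (Cp X)) (clusterSets (Cp.zero X)) →
      TwoWins k (denseSets (Cp X)) {C | d ∈ closure C}) ∧
    (TwoWinsMarkov k (denseSets (Cp X)) (clusterSets (Cp.zero X)) →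
      TwoWinsMarkov k (denseSets (Cp X)) {C | d ∈ closure C}) := by
  let s : Cp X → Cp X := fun f => ⟨fun x => f.1 x + d.1 x, f.2.add d.2⟩
  have hs : ∀ D : denseSets (Cp X), s ⁻¹' (D : Set (Cp X)) ∈ denseSets (Cp X) := fun D f => by
    rw [mem_closure_Cp]
    intro F hF ε hε
    obtain ⟨a, ha, haF⟩ := mem_closure_Cp.1 (D.2 (s f)) F hF ε hε
    refine ⟨⟨fun x => a.1 x - d.1 x, a.2.sub d.2⟩, ?_, fun x hx => ?_⟩
    · simpa [s] using ha
    · have := haF x hx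
      rwa [← sub_sub, sub_right_comm] at this
  refine transfer (fun _ D => ⟨_, hs D⟩) (fun _ _ B => s '' B)
    (fun _ _ _ hB => hB.image fun _ hf => hf) fun A B _ hout => ?_
  refine mem_closure_Cp.2 fun F hF ε hε => ?_
  obtain ⟨f, hf, hfF⟩ := mem_closure_Cp.1 hout.1 F hF ε hε
  refine ⟨s f, ?_, fun x hx => by simpa [s, Cp.zero] using hfF x hx⟩
  rw [← image_iUnion]
  exact mem_image_of_mem s hf

theorem transfer_denseSets [TopologicalSpace.SeparableSpace (Cp X)] :
    (TwoWins k (denseSets (Cp X)) (clusterSets (Cp.zero X)) →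
      TwoWins k (denseSets (Cp X)) (denseSets (Cp X))) ∧
    (TwoWinsMarkov k (denseSets (Cp X)) (clusterSets (Cp.zero X)) →
      TwoWinsMarkov k (denseSets (Cp X)) (denseSets (Cp X))) := by
  have : Nonempty (Cp X) := ⟨Cp.zero X⟩
  let d := TopologicalSpace.denseSeq (Cp X)
  have hd : {C | ∀ i, ∃ B ∈ {C : Set (Cp X) | d i ∈ closure C}, B ⊆ C} ⊆ denseSets (Cp X) := by
    intro C hC
    have hsub : range d ⊆ closure C := by
      rintro _ ⟨i, rfl⟩
      obtain ⟨B, hB, hBC⟩ := hC i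
      exact closure_mono hBC hB
    exact dense_closure.1 ((TopologicalSpace.denseRange_denseSeq (Cp X)).mono hsub)
  have hmono := transfer (k := k) (𝒜 := denseSets (Cp X)) (fun _ D => D) (fun _ _ B => B)
    (fun _ _ _ hB => hB) fun _ _ _ h => hd h
  exact ⟨fun h => hmono.1 (twoWins_threads fun i => (transfer_translate (d i)).1 h),
    fun h => hmono.2 (twoWinsMarkov_threads fun i => (transfer_translate (d i)).2 h)⟩

end Transfers

end SelGame

theorem mainTheorem5 {X : Type u} [TopologicalSpace X] [T35Space X] [Nonempty X]
    (hX : SelGame.iw X = ℵ₀) (k : SelGame.Kind) :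
    [SelGame.TwoWins k (SelGame.omegaCovers X) (SelGame.omegaCovers X),
      SelGame.TwoWins k (SelGame.clusterSets (SelGame.Cp.zero X))
        (SelGame.clusterSets (SelGame.Cp.zero X)),
      SelGame.TwoWins k (SelGame.denseSets (SelGame.Cp X))
        (SelGame.clusterSets (SelGame.Cp.zero X)),
      SelGame.TwoWins k (SelGame.denseSets (SelGame.Cp X))
        (SelGame.denseSets (SelGame.Cp X))].TFAE ∧
    [SelGame.TwoWinsMarkov k (SelGame.omegaCovers X) (SelGame.omegaCovers X),
      SelGame.TwoWinsMarkov k (SelGame.clusterSets (SelGame.Cp.zero X))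
        (SelGame.clusterSets (SelGame.Cp.zero X)),
      SelGame.TwoWinsMarkov k (SelGame.denseSets (SelGame.Cp X))
        (SelGame.clusterSets (SelGame.Cp.zero X)),
      SelGame.TwoWinsMarkov k (SelGame.denseSets (SelGame.Cp X))
        (SelGame.denseSets (SelGame.Cp X))].TFAE := by
  have := SelGame.separableSpace_Cp hX
  constructor
  · tfae_have 1 → 2 := SelGame.transfer_omegaCovers_clusterSets.1
    tfae_have 2 → 3 := SelGame.transfer_clusterSets_denseSets.1
    tfae_have 3 → 1 := SelGame.transfer_denseSets_omegaCovers.1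
    tfae_have 3 → 4 := SelGame.transfer_denseSets.1
    tfae_have 4 → 3 := SelGame.transfer_denseSets_clusterSets.1
    tfae_finish
  · tfae_have 1 → 2 := SelGame.transfer_omegaCovers_clusterSets.2
    tfae_have 2 → 3 := SelGame.transfer_clusterSets_denseSets.2
    tfae_have 3 → 1 := SelGame.transfer_denseSets_omegaCovers.2
    tfae_have 3 → 4 := SelGame.transfer_denseSets.2
    tfae_have 4 → 3 := SelGame.transfer_denseSets_clusterSets.2
    tfae_finish
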